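/- Let $m\ge 3$, let $\mathbb S_m$ be the set of rankings of $m$ alternatives, i.e. permutations $x$ of $[m]$ with $x(\text{rank})=\text{name}$, so that $x^{-1}(j)$ is the rank of alternative $j$. For $\varepsilon\in\mathbb R$, a function $f:\mathbb S_m^n\to\mathbb S_m$ is called $\varepsilon$-IR if $$\sum_{i\in[n],\,j\in[m]}\Pr_{x^{-i}\in\mathbb S_m^{n-1},\;x_i,y_i\in\mathbb S_m}\Big[x_i^{-1}(j)=y_i^{-1}(j)\ \wedge\ f(x^{-i},x_i)^{-1}(j)\ne f(x^{-i},y_i)^{-1}(j)\Big]\le\varepsilon,$$ where $x^{-i},x_i,y_i$ are independent and uniformly distributed. There is an absolute constant $C>0$ such that for all $m\ge 3$, all $n\ge 0$, all $\varepsilon$ and every $\varepsilon$-IR function $f:\mathbb S_m^n\to\mathbb S_m$ there is a function $h:\mathbb S_m^n\to\mathbb S_m$ which is either constant or dictatorial, the latter meaning that there are a voter $i\in[n]$ and a fixed permutation $y$ of the ranks such that $h(x)(r)=x_i(y(r))$ for all profiles $x$ and all ranks $r$, and which satisfies $$\Pr_x[f(x)\ne h(x)]\le C\,m^8\,\varepsilon\qquad\text{and}\qquad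 \mathbb E_x\big\|P(f(x))-P(h(x))\big\|_2^2\le C\,m^8\,\varepsilon,$$ where $x$ is uniform in $\mathbb S_m^n$, $P(z)$ is the $m\times m$ permutation matrix of $z\in\mathbb S_m$, and $\|\cdot\|_2$ is the Frobenius norm. -/

import Mathlib

open Finset

namespace RobustSWF

/-- The probability of the event `p` under the uniform distribution on a finite type. -/
noncomputable def unifProb {α : Type*} [Fintype α] (p : α → Prop) [DecidablePred p] : ℝ :=
  ((univ.filter p).card : ℝ) / (Fintype.card α : ℝ)

/-- A ranking of `m` alternatives: a permutation `x` with the convention `x rank = name`.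
Thus `x.symm j` is the rank which `x` gives to the alternative `j`. -/
abbrev Ranking (m : ℕ) : Type := Equiv.Perm (Fin m)

/-- A voting profile: one ranking for each of the `n` voters. -/
abbrev Profile (m n : ℕ) : Type := Fin n → Ranking m

/-- A social aggregator (social welfare function). -/
abbrev Aggregator (m n : ℕ) : Type := Profile m n → Ranking m

/-- The profile `x` and the profile `(x⁻ⁱ, yᵢ)` violate the independence constraint of the voter
`i` and the alternative `j`: voter `i` ranks `j` equally in both, yet the aggregated ranks of `j`
differ. -/
def Violates {m n : ℕ} (f : Aggregator m n) (i : Fin n) (j : Fin m)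
    (x : Profile m n) (yi : Ranking m) : Prop :=
  (x i).symm j = yi.symm j ∧ (f x).symm j ≠ (f (Function.update x i yi)).symm j

instance {m n : ℕ} (f : Aggregator m n) (i : Fin n) (j : Fin m) :
    DecidablePred fun q : Profile m n × Ranking m => Violates f i j q.1 q.2 :=
  fun q => inferInstanceAs (Decidable
    ((q.1 i).symm j = q.2.symm j ∧ (f q.1).symm j ≠ (f (Function.update q.1 i q.2)).symm j))

/-- The rate of violated constraints, summed over voters and alternatives. The profile
`x = (x⁻ⁱ, xᵢ)` and the ranking `yᵢ` are independent and uniform. -/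
noncomputable def irRate {m n : ℕ} (f : Aggregator m n) : ℝ :=
  ∑ i : Fin n, ∑ j : Fin m, unifProb fun q : Profile m n × Ranking m => Violates f i j q.1 q.2

/-- `f` is `ε`-IR (IR = independence of rankings). -/
def IsEpsIR {m n : ℕ} (ε : ℝ) (f : Aggregator m n) : Prop :=
  irRate f ≤ ε

/-- `f` is a constant function. -/
def IsConstant {m n : ℕ} (f : Aggregator m n) : Prop :=
  ∃ z : Ranking m, ∀ x, f x = z

/-- `f` is dictatorial: for a voter `i` and a constant permutation `y` of the ranks, the
alternative which `f x` places at rank `r` is the one which voter `i` places at rank `y r`. -/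
def IsDictatorial {m n : ℕ} (f : Aggregator m n) : Prop :=
  ∃ (i : Fin n) (y : Equiv.Perm (Fin m)), ∀ x, ∀ r : Fin m, f x r = x i (y r)

/-- The fraction of the profiles on which `f` and `h` differ. -/
noncomputable def dist {m n : ℕ} (f h : Aggregator m n) : ℝ :=
  unifProb fun x => f x ≠ h x

/-- The squared `L²` distance `𝔼ₓ ‖P(f x) - P(h x)‖²` (Frobenius norm) of the encodings of
`f` and `h` by permutation matrices. -/
noncomputable def distL2Sq {m n : ℕ} (f h : Aggregator m n) : ℝ :=
  (∑ x : Profile m n, ∑ r : Fin m, ∑ j : Fin m,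
      ((f x).permMatrix ℝ r j - (h x).permMatrix ℝ r j) ^ 2) / (Fintype.card (Profile m n) : ℝ)

end RobustSWF

/-! Fix an alternative k and condition on the vector of ranks which the voters give it. The
violation rate at k bounds the total influence of the remaining data on the aggregated rank of k, so
this rank is nearly a function G_k of that vector (`exists_decoder`).

The heart is a stability property of G_j that uses three distinct alternatives j, k, l. From two
independent rank vectors b, c of j, four uniform profiles are made by two switches: voters before a
time σ exchange j with l, the others exchange j with k. Every alternative but j ignores one of the
switches, so at each of them the four outcomes form two equal unordered pairs. The outcomes being
permutations, the same holds at j: crossing b and c over at σ rarely changes the pair of values of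
G_j (`crossingStable_decoder`). Here σ may be a stopping time.

Such a function is close to one of a single coordinate (`CrossingStable.exists_close`). If it is far
from constant, fixed times suffice: at each time the past or the future has little influence, and
the coordinate where this changes decides (`exists_dictator`). If it is nearly constant, crossing
over when an exceptional value first becomes fairly likely tends to destroy that value, so
exceptional values are as rare as failures of stability (`expect_ne_le_of_small`).

Once each aggregated rank is decoded from one voter with total error below 1/m², the decoders never
collide on inputs that can occur together, and such a family is constant or dictatorial
(`exists_constant_or_dictatorial`). -/

namespace RobustSWF

open scoped BigOperators

/-! ### Indicators and uniform averages. -/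

section Averages

variable {α β : Type*} [Fintype α] [Fintype β]

/-- The indicator of a proposition, as a real number. -/
noncomputable def ind (p : Prop) : ℝ := open Classical in if p then 1 else 0

lemma ind_of {p : Prop} (h : p) : ind p = 1 := if_pos h

lemma ind_of_not {p : Prop} (h : ¬p) : ind p = 0 := if_neg h

lemma ind_nonneg (p : Prop) : 0 ≤ ind p := by
  by_cases h : p <;> simp [ind, h]

lemma ind_le_one (p : Prop) : ind p ≤ 1 := by
  by_cases h : p <;> simp [ind, h]

lemma ind_mono {p q : Prop} (h : p → q) : ind p ≤ ind q := by
  by_cases hp : p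
  · rw [ind_of hp, ind_of (h hp)]
  · rw [ind_of_not hp]; exact ind_nonneg q

lemma ind_congr {p q : Prop} (h : p ↔ q) : ind p = ind q := by rw [propext h]

lemma ind_le_add {p q r : Prop} (h : p → q ∨ r) : ind p ≤ ind q + ind r := by
  by_cases hp : p
  · rcases h hp with h | h
    · rw [ind_of hp, ind_of h]; linarith [ind_nonneg r]
    · rw [ind_of hp, ind_of h]; linarith [ind_nonneg q]
  · rw [ind_of_not hp]; exact add_nonneg (ind_nonneg q) (ind_nonneg r)

lemma ind_exists_le_sum (p : α → Prop) : ind (∃ a, p a) ≤ ∑ a, ind (p a) := by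
  by_cases h : ∃ a, p a
  · obtain ⟨a, ha⟩ := h
    rw [ind_of ⟨a, ha⟩, ← ind_of ha]
    exact single_le_sum (f := fun a => ind (p a)) (fun a _ => ind_nonneg _) (mem_univ a)
  · rw [ind_of_not h]; exact sum_nonneg fun a _ => ind_nonneg _

lemma expect_mono {f g : α → ℝ} (h : ∀ a, f a ≤ g a) : 𝔼 a, f a ≤ 𝔼 a, g a :=
  expect_le_expect fun a _ => h a

lemma expect_congr_fun {f g : α → ℝ} (h : ∀ a, f a = g a) : 𝔼 a, f a = 𝔼 a, g a :=
  expect_congr rfl fun a _ => h a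

lemma expect_prod (f : α × β → ℝ) : 𝔼 q, f q = 𝔼 a, 𝔼 b, f (a, b) := by
  rw [← univ_product_univ, expect_product]

lemma expect_ind_nonneg (p : α → Prop) : 0 ≤ 𝔼 a, ind (p a) :=
  expect_nonneg fun _ _ => ind_nonneg _

lemma expect_ind_le_one [Nonempty α] (p : α → Prop) : 𝔼 a, ind (p a) ≤ 1 :=
  expect_le univ_nonempty fun _ _ => ind_le_one _

lemma unifProb_eq_expect (p : α → Prop) [DecidablePred p] : unifProb p = 𝔼 a, ind (p a) := by
  rw [Fintype.expect_eq_sum_div_card, unifProb]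
  congr 1
  rw [card_filter, Nat.cast_sum]
  refine sum_congr rfl fun a _ => ?_
  by_cases h : p a <;> simp [ind, h]

/-- An injective map between sets of equal size preserves uniform averages. -/
lemma expect_comp_injective {e : α → β} (he : Function.Injective e)
    (hc : Fintype.card α = Fintype.card β) (f : β → ℝ) : 𝔼 a, f (e a) = 𝔼 b, f b :=
  Fintype.expect_bijective e ((Fintype.bijective_iff_injective_and_card e).2 ⟨he, hc⟩) _ _
    fun _ => rfl

end Averages

/-! ### Crossover at adapted times and the hybrid argument. -/

section Mixing

variable {n : ℕ} {α : Type*}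

/-- The coordinates below `t` of `b` followed by the other coordinates of `c`. -/
def mix (t : ℕ) (b c : Fin n → α) : Fin n → α := fun i => if (i : ℕ) < t then b i else c i

lemma mix_zero (b c : Fin n → α) : mix 0 b c = c := by funext i; simp [mix]

lemma mix_of_le {t : ℕ} (ht : n ≤ t) (b c : Fin n → α) : mix t b c = b := by
  funext i; simp [mix, i.2.trans_le ht]

lemma mix_self (t : ℕ) (b : Fin n → α) : mix t b b = b := by funext i; simp [mix]

lemma mix_mix (t : ℕ) (b c d e : Fin n → α) : mix t (mix t b c) (mix t d e) = mix t b e := by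
  funext i; simp only [mix]; split_ifs <;> rfl

lemma mix_mix_left (t : ℕ) (b c d : Fin n → α) : mix t (mix t b c) d = mix t b d := by
  funext i; simp only [mix]; split_ifs <;> rfl

lemma mix_mix_right (t : ℕ) (b c d : Fin n → α) : mix t b (mix t c d) = mix t b d := by
  funext i; simp only [mix]; split_ifs <;> rfl

lemma mix_succ_eq_update (i : Fin n) (b c : Fin n → α) :
    mix (i + 1) b c = Function.update (mix i b c) i (b i) := by
  funext k
  by_cases h : k = i
  · subst h; simp [mix]
  · have : (k : ℕ) ≠ i := fun h' => h (Fin.ext h')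
    simp only [mix, Function.update_of_ne h]
    congr 1
    exact propext ⟨by omega, by omega⟩

lemma mix_update_eq_mix_succ (i : Fin n) (b c : Fin n → α) :
    mix i b (Function.update c i (b i)) = mix (i + 1) b c := by
  funext k
  by_cases h : k = i
  · subst h; simp [mix]
  · have : (k : ℕ) ≠ i := fun h' => h (Fin.ext h')
    simp only [mix, Function.update_of_ne h]
    congr 1
    exact propext ⟨by omega, by omega⟩

lemma mix_succ_mix_update (i : Fin n) (b c : Fin n → α) :
    mix (i + 1) (mix i c b) c = Function.update c i (b i) := by
  funext k
  by_cases h : k = i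
  · subst h; simp [mix]
  · have : (k : ℕ) ≠ i := fun h' => h (Fin.ext h')
    simp only [mix, Function.update_of_ne h]
    split_ifs <;> first | rfl | omega

/-- The number `σ b` is determined by the first `σ b` coordinates of `b`. -/
def IsAdapted (σ : (Fin n → α) → ℕ) : Prop :=
  ∀ b c : Fin n → α, (∀ i : Fin n, (i : ℕ) < σ b → c i = b i) → σ c = σ b

lemma isAdapted_const (t : ℕ) : IsAdapted fun _ : Fin n → α => t := fun _ _ _ => rfl

lemma IsAdapted.apply_mix {σ : (Fin n → α) → ℕ} (hσ : IsAdapted σ) (b c : Fin n → α) :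
    σ (mix (σ b) b c) = σ b :=
  hσ _ _ fun i hi => by simp [mix, hi]

variable [Fintype α]

/-- Exchanging the coordinates behind an adapted time preserves independent uniform pairs. -/
lemma expect_crossover {σ : (Fin n → α) → ℕ} (hσ : IsAdapted σ)
    (φ : (Fin n → α) → (Fin n → α) → ℝ) :
    𝔼 b, 𝔼 c, φ (mix (σ b) b c) (mix (σ b) c b) = 𝔼 b, 𝔼 c, φ b c := by
  -- By adaptedness the crossover does not change its own time, so repeating it undoes it.
  have key : Function.Involutive
      fun q : (Fin n → α) × (Fin n → α) => (mix (σ q.1) q.1 q.2, mix (σ q.1) q.2 q.1) := by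
    rintro ⟨b, c⟩
    simp only [hσ.apply_mix, mix_mix, mix_self]
  rw [← expect_prod fun q => φ (mix (σ q.1) q.1 q.2) (mix (σ q.1) q.2 q.1),
    ← expect_prod fun q => φ q.1 q.2]
  exact Fintype.expect_bijective _ key.bijective _ _ fun _ => rfl

lemma expect_mix [Nonempty α] (t : ℕ) (φ : (Fin n → α) → ℝ) :
    𝔼 b, 𝔼 c, φ (mix t b c) = 𝔼 b, φ b := by
  rw [expect_crossover (isAdapted_const t) fun b _ => φ b]
  exact expect_congr_fun fun b => Fintype.expect_const _

lemma expect_update [Nonempty α] (i : Fin n) (φ : (Fin n → α) → ℝ) :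
    𝔼 b, 𝔼 a, φ (Function.update b i a) = 𝔼 b, φ b := by
  have key : Function.Involutive
      fun q : (Fin n → α) × α => (Function.update q.1 i q.2, q.1 i) := by
    rintro ⟨b, a⟩
    simp
  rw [← expect_prod fun q : (Fin n → α) × α => φ (Function.update q.1 i q.2),
    Fintype.expect_bijective _ key.bijective _ (fun q => φ q.1) fun _ => rfl, expect_prod]
  exact expect_congr_fun fun b => Fintype.expect_const (φ b)

lemma expect_eval [Nonempty α] (i : Fin n) (φ : α → ℝ) :
    𝔼 b : Fin n → α, φ (b i) = 𝔼 a, φ a := by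
  rw [← expect_update i fun b => φ (b i)]
  simp only [Function.update_self]
  exact Fintype.expect_const _

/-- The change made by one step of the hybrid between independent points is an influence. -/
lemma expect_ne_mix_succ [Nonempty α] {V : Type*} (H : (Fin n → α) → V) (i : Fin n) :
    𝔼 b, 𝔼 c, ind (H (mix i c b) ≠ H (mix (i + 1) c b)) =
      𝔼 b, 𝔼 a, ind (H b ≠ H (Function.update b i a)) := by
  have h1 : 𝔼 b, 𝔼 c, ind (H (mix i c b) ≠ H (mix (i + 1) c b)) =
      𝔼 c, 𝔼 b, (fun d e => ind (H d ≠ H (Function.update d i (e i))))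
        (mix i c b) (mix i b c) := by
    rw [expect_comm]
    refine expect_congr_fun fun c => expect_congr_fun fun b => ?_
    simp only [mix_succ_eq_update i c b]
    simp [mix]
  rw [h1, expect_crossover (isAdapted_const (i : ℕ))
    fun d e => ind (H d ≠ H (Function.update d i (e i)))]
  exact expect_congr_fun fun d =>
    expect_eval i fun a => ind (H d ≠ H (Function.update d i a))

/-- A function on a product space is within its total influence of a constant. -/
lemma exists_expect_ne_le_sum_influence [Nonempty α] {V : Type*} (H : (Fin n → α) → V) :
    ∃ v, 𝔼 b, ind (H b ≠ v) ≤ ∑ i, 𝔼 b, 𝔼 a, ind (H b ≠ H (Function.update b i a)) := by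
  set J : Fin n → ℝ := fun i => 𝔼 b, 𝔼 a, ind (H b ≠ H (Function.update b i a)) with hJ
  -- Hybrid argument: the coordinates of `b` are replaced by those of `c` one at a time, each at the
  -- cost of one influence. An average choice of `c` then provides the constant `H c`.
  have step : ∀ t ≤ n, 𝔼 b, 𝔼 c, ind (H b ≠ H (mix t c b)) ≤
      ∑ i ∈ range t, if h : i < n then J ⟨i, h⟩ else 0 := by
    intro t
    induction t with
    | zero =>
      intro _
      simp [mix_zero, ind]
    | succ t ih =>
      intro ht
      rw [sum_range_succ, dif_pos (show t < n from ht), hJ]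
      simp only
      rw [← expect_ne_mix_succ]
      refine le_trans (expect_mono fun b => expect_mono fun c => ind_le_add
        (q := H b ≠ H (mix t c b)) (r := H (mix t c b) ≠ H (mix (t + 1) c b)) fun h => ?_) ?_
      · by_contra! h'
        exact h (h'.1.trans h'.2)
      · simp only [expect_add_distrib]
        exact add_le_add_left (ih (by omega)) _
  have h := step n le_rfl
  simp only [mix_of_le le_rfl] at h
  rw [expect_comm, ← Fin.sum_univ_eq_sum_range (fun i => if h : i < n then J ⟨i, h⟩ else 0)] at h
  simp only [Fin.is_lt, dif_pos, Fin.eta] at h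
  obtain ⟨c, -, hc⟩ := exists_le_of_expect_le univ_nonempty h
  exact ⟨H c, hc⟩

end Mixing

/-! ### Stability under crossover for two blocks of variables. -/

section TwoParty

/-- The unordered pairs `{p, q}` and `{r, s}` are equal. -/
def SamePair {V : Type*} (p q r s : V) : Prop := (p = r ∧ q = s) ∨ (p = s ∧ q = r)

variable {X Y V : Type*} [Fintype X] [Fintype Y] [Nonempty X] [Nonempty Y]

/-- If resampling is compatible with exchanging the second argument, then one of the two
arguments has little influence. -/
lemma influence_mul_influence_le (Q : X → Y → V) {η : ℝ}
    (h : 𝔼 x, 𝔼 x', 𝔼 y, 𝔼 y', ind (¬SamePair (Q x y) (Q x' y') (Q x y') (Q x' y)) ≤ η) :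
    (𝔼 x, 𝔼 x', 𝔼 w, ind (Q x w ≠ Q x' w)) * (𝔼 z, 𝔼 y, 𝔼 y', ind (Q z y ≠ Q z y')) ≤ 3 * η := by
  set T : X → X → Y → Y → ℝ := fun x x' y y' =>
    ind (¬SamePair (Q x y) (Q x' y') (Q x y') (Q x' y)) with hT
  -- If `Q x w ≠ Q x' w`, the first pair relation forces `Q x y ≠ Q x' y`; if `Q z y ≠ Q z y'`, the
  -- second forces `Q x y ≠ Q x y'`. Together these contradict the third.
  have pt : ∀ x x' w z y y', ind (Q x w ≠ Q x' w) * ind (Q z y ≠ Q z y') ≤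
      T x x' y w + T x z y y' + T x x' y y' := by
    intro x x' w z y y'
    have n1 := ind_nonneg (¬SamePair (Q x y) (Q x' w) (Q x w) (Q x' y))
    have n2 := ind_nonneg (¬SamePair (Q x y) (Q z y') (Q x y') (Q z y))
    have n3 := ind_nonneg (¬SamePair (Q x y) (Q x' y') (Q x y') (Q x' y))
    by_cases e1 : Q x w ≠ Q x' w
    · by_cases e2 : Q z y ≠ Q z y'
      · rw [ind_of e1, ind_of e2]
        simp only [hT]
        by_cases t1 : SamePair (Q x y) (Q x' w) (Q x w) (Q x' y)
        · by_cases t2 : SamePair (Q x y) (Q z y') (Q x y') (Q z y)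
          · have t3 : ¬SamePair (Q x y) (Q x' y') (Q x y') (Q x' y) := by
              simp only [SamePair] at *
              grind
            rw [ind_of t3]; linarith
          · rw [ind_of t2]; linarith
        · rw [ind_of t1]; linarith
      · rw [ind_of_not e2]; simp only [hT]; linarith
    · rw [ind_of_not e1]; simp only [hT]; linarith
  calc _ = 𝔼 x, 𝔼 x', 𝔼 w, 𝔼 z, 𝔼 y, 𝔼 y', ind (Q x w ≠ Q x' w) * ind (Q z y ≠ Q z y') := by
        simp only [expect_mul]
        simp only [mul_expect]
    _ ≤ 𝔼 x, 𝔼 x', 𝔼 w, 𝔼 z, 𝔼 y, 𝔼 y', (T x x' y w + T x z y y' + T x x' y y') :=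
        expect_mono fun x => expect_mono fun x' => expect_mono fun w => expect_mono fun z =>
          expect_mono fun y => expect_mono fun y' => pt x x' w z y y'
    _ = (𝔼 x, 𝔼 x', 𝔼 w, 𝔼 y, T x x' y w) + (𝔼 x, 𝔼 z, 𝔼 y, 𝔼 y', T x z y y') +
        𝔼 x, 𝔼 x', 𝔼 y, 𝔼 y', T x x' y y' := by
        simp only [expect_add_distrib, Fintype.expect_const]
    _ = 3 * 𝔼 x, 𝔼 x', 𝔼 y, 𝔼 y', T x x' y y' := by
        have : ∀ x x', 𝔼 w, 𝔼 y, T x x' y w = 𝔼 y, 𝔼 w, T x x' y w := fun x x' => expect_comm _ _ _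
        simp only [this]
        ring
    _ ≤ 3 * η := by linarith

end TwoParty

/-! ### Crossing stable functions far from constant. -/

section Crossing

variable {n : ℕ} {α V : Type*} [Fintype α]

/-- With probability at least `1 - η`, exchanging the coordinates of two independent points behind
an adapted time does not change the pair of values of `G`. -/
def CrossingStable (η : ℝ) (G : (Fin n → α) → V) : Prop :=
  ∀ σ : (Fin n → α) → ℕ, IsAdapted σ →
    𝔼 b, 𝔼 c, ind (¬SamePair (G b) (G c) (G (mix (σ b) b c)) (G (mix (σ b) c b))) ≤ η

/-- The influence of the coordinates below `t`. -/
noncomputable def lowInfluence (G : (Fin n → α) → V) (t : ℕ) : ℝ :=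
  𝔼 b, 𝔼 c, ind (G b ≠ G (mix t c b))

/-- The influence of the coordinates from `t` on. -/
noncomputable def highInfluence (G : (Fin n → α) → V) (t : ℕ) : ℝ :=
  𝔼 b, 𝔼 c, ind (G b ≠ G (mix t b c))

lemma expect_ne_le_low_add_high (G : (Fin n → α) → V) (t : ℕ) :
    𝔼 b, 𝔼 c, ind (G b ≠ G c) ≤ lowInfluence G t + highInfluence G t := by
  have h : highInfluence G t = 𝔼 b, 𝔼 c, ind (G (mix t c b) ≠ G c) := by
    rw [highInfluence, ← expect_crossover (isAdapted_const t), expect_comm]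
    simp only [mix_mix, mix_self]
  rw [h, lowInfluence, ← expect_add_distrib]
  refine expect_mono fun b => ?_
  rw [← expect_add_distrib]
  refine expect_mono fun c => ind_le_add fun h => ?_
  by_contra! h'
  exact h (h'.1.trans h'.2)

/-- At a fixed time, past and future are two independent blocks, to which
`influence_mul_influence_le` applies. -/
lemma low_mul_high_le [Nonempty α] {η : ℝ} {G : (Fin n → α) → V} (hG : CrossingStable η G)
    (t : ℕ) : lowInfluence G t * highInfluence G t ≤ 3 * η := by
  have h1 : lowInfluence G t = 𝔼 x, 𝔼 x', 𝔼 w, ind (G (mix t x w) ≠ G (mix t x' w)) := by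
    rw [lowInfluence, ← expect_mix t]
    simp only [mix_mix_right]
    refine expect_congr_fun fun x => expect_comm _ _ _
  have h2 : highInfluence G t = 𝔼 z, 𝔼 y, 𝔼 y', ind (G (mix t z y) ≠ G (mix t z y')) := by
    rw [highInfluence, ← expect_mix t]
    simp only [mix_mix_left]
  rw [h1, h2]
  refine influence_mul_influence_le (fun x y => G (mix t x y)) (le_trans (le_of_eq ?_)
    (hG (fun _ => t) (isAdapted_const t)))
  symm
  rw [← expect_mix t]
  refine expect_congr_fun fun x => ?_
  rw [expect_comm univ univ fun x' y => 𝔼 y', ind (¬SamePair (G (mix t x y)) (G (mix t x' y'))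
    (G (mix t x y')) (G (mix t x' y)))]
  refine expect_congr_fun fun y => ?_
  rw [← expect_mix t]
  simp only [mix_mix]

/-- Some coordinate almost determines a crossing stable function that is far from constant. -/
lemma exists_dictator [Nonempty α] {η τ : ℝ} {G : (Fin n → α) → V} (hG : CrossingStable η G)
    (hτ : 0 < τ) (hle : τ ≤ 𝔼 b, 𝔼 c, ind (G b ≠ G c)) (hη : 6 * η < τ ^ 2) :
    ∃ (s : Fin n) (g : α → V), 𝔼 b, ind (G b ≠ g (b s)) ≤ 12 * η / τ := by
  classical
  -- The two influences sum to at least `τ`, so one is at least `τ / 2` and the product bound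
  -- controls the other.
  have hall : ∀ t, lowInfluence G t ≤ 6 * η / τ ∨ highInfluence G t ≤ 6 * η / τ := by
    intro t
    have h1 := low_mul_high_le hG t
    have h2 := hle.trans (expect_ne_le_low_add_high G t)
    have h3 : 0 ≤ lowInfluence G t := expect_nonneg fun _ _ => expect_ind_nonneg _
    have h4 : 0 ≤ highInfluence G t := expect_nonneg fun _ _ => expect_ind_nonneg _
    rw [le_div_iff₀ hτ, le_div_iff₀ hτ]
    rcases le_total (τ / 2) (lowInfluence G t) with h | h
    · right; nlinarith
    · left; nlinarith
  have hn : highInfluence G n ≤ 6 * η / τ := by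
    have h0 : highInfluence G n = 0 := by simp [highInfluence, mix_of_le le_rfl, ind]
    have hη0 : 0 ≤ η := le_trans (expect_nonneg fun _ _ => expect_ind_nonneg _)
      (hG _ (isAdapted_const 0))
    rw [h0]
    positivity
  have hex : ∃ t, highInfluence G t ≤ 6 * η / τ := ⟨n, hn⟩
  have hspec := Nat.find_spec hex
  have hmin := fun s => Nat.find_min hex (m := s)
  have hfn : Nat.find hex ≤ n := Nat.find_min' hex hn
  obtain ⟨t, ht⟩ : ∃ t, Nat.find hex = t := ⟨_, rfl⟩
  rw [ht] at hspec hmin hfn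
  -- The first time with small future influence is not 0: there the future is everything, with
  -- influence at least `τ`, against `6 * η < τ ^ 2`.
  obtain _ | s := t
  · exfalso
    have h0 : highInfluence G 0 = 𝔼 b, 𝔼 c, ind (G b ≠ G c) := by
      simp only [highInfluence, mix_zero]
    rw [h0, le_div_iff₀ hτ] at hspec
    nlinarith
  -- By minimality the future from `s` still matters, so the past before `s` does not. Replacing
  -- first that past, then the future from `s + 1`, keeps only coordinate `s` of `b`.
  · have hlow : lowInfluence G s ≤ 6 * η / τ := (hall s).resolve_right (hmin s s.lt_succ_self)
    obtain ⟨i, hi⟩ : ∃ i : Fin n, (i : ℕ) = s := ⟨⟨s, hfn⟩, rfl⟩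
    have hhigh : highInfluence G (s + 1) =
        𝔼 b, 𝔼 c, ind (G (mix s c b) ≠ G (Function.update c i (b i))) := by
      rw [highInfluence, ← expect_crossover (isAdapted_const s), expect_comm]
      refine expect_congr_fun fun b => expect_congr_fun fun c => ?_
      rw [← mix_succ_mix_update i b c, hi]
      congr 3
      funext k
      simp only [mix]
      split_ifs <;> first | rfl | omega
    have hsum : 𝔼 c, 𝔼 b, ind (G b ≠ G (Function.update c i (b i))) ≤ 12 * η / τ := by
      calc _ = 𝔼 b, 𝔼 c, ind (G b ≠ G (Function.update c i (b i))) := expect_comm _ _ _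
        _ ≤ lowInfluence G s + highInfluence G (s + 1) := by
          rw [hhigh, lowInfluence, ← expect_add_distrib]
          refine expect_mono fun b => ?_
          rw [← expect_add_distrib]
          refine expect_mono fun c => ind_le_add fun h => ?_
          by_contra! h'
          exact h (h'.1.trans h'.2)
        _ ≤ 6 * η / τ + 6 * η / τ := add_le_add hlow hspec
        _ = 12 * η / τ := by ring
    obtain ⟨c, -, hc⟩ := exists_le_of_expect_le univ_nonempty hsum
    exact ⟨i, fun a => G (Function.update c i a), hc⟩

end Crossing

/-! ### Nearly constant crossing stable functions: a stopping time argument. -/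

section SmallDeviation

variable {n : ℕ} {α V : Type*} [Fintype α]

/-- The conditional probability of `G ≠ v`, given the coordinates below `t`. -/
noncomputable def condProb (G : (Fin n → α) → V) (v : V) (t : ℕ) (b : Fin n → α) : ℝ :=
  𝔼 c, ind (G (mix t b c) ≠ v)

lemma condProb_mix (G : (Fin n → α) → V) (v : V) (t : ℕ) (b c : Fin n → α) :
    condProb G v t (mix t b c) = condProb G v t b := by
  simp only [condProb, mix_mix_left]

lemma condProb_zero (G : (Fin n → α) → V) (v : V) (b : Fin n → α) :
    condProb G v 0 b = 𝔼 c, ind (G c ≠ v) := by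
  simp only [condProb, mix_zero]

lemma condProb_of_le [Nonempty α] (G : (Fin n → α) → V) (v : V) {t : ℕ} (ht : n ≤ t)
    (b : Fin n → α) : condProb G v t b = ind (G b ≠ v) := by
  simp only [condProb, mix_of_le ht]
  exact Fintype.expect_const _

/-- The revealed value of the next coordinate has probability `1 / Fintype.card α`, so conditioning
on it gains at most this factor. -/
lemma condProb_succ_le [Nonempty α] (G : (Fin n → α) → V) (v : V) (t : ℕ) (b : Fin n → α) :
    condProb G v (t + 1) b ≤ Fintype.card α * condProb G v t b := by
  have hα : (1 : ℝ) ≤ Fintype.card α := by exact_mod_cast Fintype.card_pos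
  by_cases ht : t < n
  · have h : condProb G v (t + 1) b / Fintype.card α ≤ condProb G v t b := by
      rw [condProb, condProb, ← expect_update ⟨t, ht⟩ fun c => ind (G (mix t b c) ≠ v), expect_div]
      refine expect_mono fun c => ?_
      rw [Fintype.expect_eq_sum_div_card]
      rw [div_le_div_iff_of_pos_right (by linarith)]
      rw [← mix_update_eq_mix_succ ⟨t, ht⟩ b c]
      exact single_le_sum
        (f := fun a => ind (G (mix t b (Function.update c ⟨t, ht⟩ a)) ≠ v))
        (fun a _ => ind_nonneg _) (mem_univ (b ⟨t, ht⟩))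
    rw [div_le_iff₀ (by linarith)] at h
    linarith
  · rw [condProb_of_le G v (by omega), condProb_of_le G v (by omega)]
    nlinarith [ind_nonneg (G b ≠ v)]

open Classical in
/-- The first time at which the conditional probability of `G ≠ v` reaches `u`, and `n` if this
never happens. -/
noncomputable def hittingTime (G : (Fin n → α) → V) (v : V) (u : ℝ) (b : Fin n → α) : ℕ :=
  if h : ∃ t, u ≤ condProb G v t b then Nat.find h else n

/-- Conditional probabilities up to the hitting time only involve coordinates below it. If the level
is never reached, the default `n` makes all coordinates known. -/
lemma isAdapted_hittingTime (G : (Fin n → α) → V) (v : V) (u : ℝ) :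
    IsAdapted (hittingTime G v u) := by
  classical
  intro b c hbc
  by_cases h : ∃ t, u ≤ condProb G v t b
  · have hb : hittingTime G v u b = Nat.find h := by rw [hittingTime, dif_pos h]
    rw [hb] at hbc ⊢
    have hcond : ∀ t ≤ Nat.find h, condProb G v t c = condProb G v t b := by
      intro t ht
      have : mix t c = mix t b := by
        funext d k
        simp only [mix]
        split_ifs with hk
        · exact hbc k (by omega)
        · rfl
      simp only [condProb, this]
    have hc : ∃ t, u ≤ condProb G v t c :=
      ⟨_, (Nat.find_spec h).trans_eq (hcond _ le_rfl).symm⟩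
    rw [hittingTime, dif_pos hc, Nat.find_eq_iff]
    refine ⟨(Nat.find_spec h).trans_eq (hcond _ le_rfl).symm, fun t ht => ?_⟩
    rw [hcond t ht.le]
    exact Nat.find_min h ht
  · rw [hittingTime, dif_neg h] at hbc
    rw [show c = b from funext fun i => hbc i i.2]

/-- A crossing stable function which is equal to `v` up to a probability that is small compared
with the atoms is equal to `v` up to the order of the stability defect. -/
lemma expect_ne_le_of_small [Nonempty α] {η : ℝ} {G : (Fin n → α) → V} (hG : CrossingStable η G)
    (v : V) (hp : 𝔼 b, ind (G b ≠ v) ≤ 1 / (8 * Fintype.card α)) :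
    𝔼 b, ind (G b ≠ v) ≤ 4 * η := by
  classical
  have hα : (1 : ℝ) ≤ Fintype.card α := by exact_mod_cast Fintype.card_pos
  set m : ℝ := (Fintype.card α : ℝ) with hm
  set p : ℝ := 𝔼 b, ind (G b ≠ v) with hpdef
  have hp0 : 0 ≤ p := expect_ind_nonneg _
  -- The level lies above the starting value `p`, and an overshoot by the one-step factor `m` still
  -- ends at most at 1/2.
  set u : ℝ := 1 / (2 * m) with hu
  have hu0 : 0 < u := by positivity
  have hpm : p * (8 * m) ≤ 1 := by rwa [le_div_iff₀ (by positivity)] at hp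
  have hum : u * (2 * m) = 1 := by rw [hu]; field_simp
  have hpu : p < u := by nlinarith
  have hu1 : u ≤ 1 := by nlinarith
  set σ := hittingTime G v u with hσdef
  have hσ : IsAdapted σ := isAdapted_hittingTime G v u
  set s : (Fin n → α) → ℝ := fun b => ind (u ≤ condProb G v (σ b) b) with hs
  set B : (Fin n → α) → ℝ := fun b => ind (G b ≠ v) with hB
  have hs0 : ∀ b, 0 ≤ s b := fun b => ind_nonneg _
  have hB0 : ∀ b, 0 ≤ B b := fun b => ind_nonneg _
  have hreach : ∀ b, G b ≠ v → u ≤ condProb G v (σ b) b := by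
    intro b hb
    have h : ∃ t, u ≤ condProb G v t b := by
      refine ⟨n, ?_⟩
      rwa [condProb_of_le G v le_rfl, ind_of hb]
    rw [hσdef, hittingTime, dif_pos h]
    exact Nat.find_spec h
  have hhalf : ∀ b, u ≤ condProb G v (σ b) b → condProb G v (σ b) b ≤ 1 / 2 := by
    intro b hb
    have h : ∃ t, u ≤ condProb G v t b := ⟨_, hb⟩
    have hfind : σ b = Nat.find h := by rw [hσdef, hittingTime, dif_pos h]
    have hmin := fun t => Nat.find_min h (m := t)
    rw [← hfind] at hmin
    rcases hσb : σ b with _ | t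
    · rw [hσb, condProb_zero] at hb
      exact absurd hb (not_le.2 hpu)
    · rw [hσb] at hmin
      have h1 := not_le.1 (hmin t t.lt_succ_self)
      have h2 := condProb_succ_le G v t b
      rw [← hm] at h2
      nlinarith
  have hsB : ∀ b, s b * B b = B b := by
    intro b
    by_cases hb : G b ≠ v
    · simp only [hs, hB, ind_of hb, ind_of (hreach b hb), mul_one]
    · simp only [hB, ind_of_not hb, mul_zero]
  have hsmix : ∀ b c, s (mix (σ b) b c) = s b := by
    intro b c
    simp only [hs, hσ.apply_mix, condProb_mix]
  have e1 : 𝔼 b, s b * condProb G v (σ b) b = p := by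
    calc _ = 𝔼 b, 𝔼 c, s (mix (σ b) b c) * B (mix (σ b) b c) := by
          refine expect_congr_fun fun b => ?_
          simp only [hsmix, condProb, mul_expect, hB]
      _ = 𝔼 b, 𝔼 _c : Fin n → α, s b * B b := expect_crossover hσ fun b _ => s b * B b
      _ = p := expect_congr_fun fun b => by rw [Fintype.expect_const, hsB]
  have e2 : (𝔼 b, s b) * u ≤ p := by
    rw [← e1, expect_mul]
    refine expect_mono fun b => ?_
    by_cases hb : u ≤ condProb G v (σ b) b
    · exact mul_le_mul_of_nonneg_left hb (hs0 b)
    · simp only [hs, ind_of_not hb, zero_mul, le_refl]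
  -- As `s` depends only on the past of `b`, it is independent of the other crossed point. With
  -- Markov's inequality `e2` this yields at most `p / 4`.
  have e3 : 𝔼 b, 𝔼 c, s b * B (mix (σ b) c b) = (𝔼 b, s b) * p := by
    calc _ = 𝔼 b, 𝔼 c, s (mix (σ b) b c) * B (mix (σ b) c b) := by simp only [hsmix]
      _ = 𝔼 b, 𝔼 c, s b * B c := expect_crossover hσ fun b c => s b * B c
      _ = _ := by rw [expect_mul_expect]
  have e4 : 𝔼 b, 𝔼 c, B b * B (mix (σ b) b c) ≤ p / 2 := by
    rw [hpdef, expect_div]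
    refine expect_mono fun b => ?_
    rw [← mul_expect]
    by_cases hb : G b ≠ v
    · have := hhalf b (hreach b hb)
      simp only [hB, ind_of hb, one_mul]
      exact this
    · simp only [hB, ind_of_not hb, zero_mul, zero_div, le_refl]
  -- Stability fails when `b` is exceptional but neither crossed point is. Of the mass `p`, at most
  -- `p / 2` is lost to the first crossed point and `p / 4` to the second.
  have e5 : 𝔼 b, 𝔼 c, (B b - B b * B (mix (σ b) b c) - s b * B (mix (σ b) c b)) ≤ η := by
    refine le_trans (expect_mono fun b => expect_mono fun c => ?_) (hG σ hσ)
    have hbc : 0 ≤ s b * B (mix (σ b) c b) := mul_nonneg (hs0 _) (hB0 _)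
    have hbc' : 0 ≤ B b * B (mix (σ b) b c) := mul_nonneg (hB0 _) (hB0 _)
    by_cases hb : G b ≠ v
    · by_cases h1 : G (mix (σ b) b c) ≠ v
      · refine le_trans ?_ (ind_nonneg _)
        simp only [hB, ind_of hb, ind_of h1, mul_one] at hbc ⊢
        linarith
      · by_cases h2 : G (mix (σ b) c b) ≠ v
        · refine le_trans ?_ (ind_nonneg _)
          have : s b = 1 := ind_of (hreach b hb)
          simp only [hB, ind_of hb, ind_of h2, this, mul_one] at hbc' ⊢
          linarith
        · rw [ind_of]
          · simp only [hB, ind_of hb] at hbc hbc' ⊢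
            linarith
          · push Not at h1 h2
            rw [h1, h2]
            rintro (h | h)
            · exact hb h.1
            · exact hb h.1
    · refine le_trans ?_ (ind_nonneg _)
      simp only [hB, ind_of_not hb] at hbc hbc' ⊢
      linarith
  simp only [expect_sub_distrib, Fintype.expect_const] at e5
  rw [e3] at e5
  have e6 : (𝔼 b, s b) ≤ 2 * m * p := by nlinarith
  have e7 : (𝔼 b, s b) * p ≤ p / 4 := by nlinarith
  linarith

/-- A crossing stable function is close to a function of one coordinate. -/
lemma CrossingStable.exists_close [Nonempty α] (hn : 0 < n) {η : ℝ} {G : (Fin n → α) → V}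
    (hG : CrossingStable η G) (hη : 400 * (Fintype.card α : ℝ) ^ 2 * η ≤ 1) :
    ∃ (s : Fin n) (g : α → V), 𝔼 b, ind (G b ≠ g (b s)) ≤ 96 * Fintype.card α * η := by
  have hα : (1 : ℝ) ≤ Fintype.card α := by exact_mod_cast Fintype.card_pos
  have hη0 : 0 ≤ η := le_trans (expect_nonneg fun _ _ => expect_ind_nonneg _)
    (hG _ (isAdapted_const 0))
  set m : ℝ := (Fintype.card α : ℝ) with hm
  rcases le_total (𝔼 b, 𝔼 c, ind (G b ≠ G c)) (1 / (8 * m)) with h | h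
  · rw [expect_comm] at h
    obtain ⟨c, -, hc⟩ := exists_le_of_expect_le univ_nonempty h
    refine ⟨⟨0, hn⟩, fun _ => G c, (expect_ne_le_of_small hG (G c) hc).trans ?_⟩
    nlinarith
  -- With `τ = 1 / (8 * m)`, the condition `6 * η < τ ^ 2` reads `384 * m ^ 2 * η < 1`, and `12 * η
  -- / τ` is `96 * m * η`.
  · obtain ⟨s, g, hg⟩ := exists_dictator hG (by positivity) h (by
      rw [div_pow, lt_div_iff₀ (by positivity)]
      nlinarith)
    refine ⟨s, g, hg.trans_eq ?_⟩
    field_simp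
    ring

end SmallDeviation

/-! ### Decoding an aggregated rank from the ranks of the same alternative. -/

section Decoding

variable {m n : ℕ}

/-- The ranks which the voters give to the alternative `k`. -/
def ranks (k : Fin m) (x : Profile m n) : Fin n → Fin m := fun i => (x i).symm k

/-- The rankings which place the alternative `k` at rank `k`. -/
abbrev Fixing (k : Fin m) : Type := {z : Ranking m // z.symm k = k}

instance (k : Fin m) : Nonempty (Fixing k) := ⟨⟨1, rfl⟩⟩

/-- A ranking is given by the rank of `k` and a ranking which fixes `k`. -/
def rankEquiv (k : Fin m) : Ranking m ≃ Fin m × Fixing k where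
  toFun x := (x.symm k, ⟨x * Equiv.swap (x.symm k) k, by
    rw [← Equiv.Perm.inv_def, mul_inv_rev, Equiv.swap_inv, Equiv.Perm.mul_apply]
    simp [Equiv.Perm.inv_def]⟩)
  invFun q := q.2.1 * Equiv.swap q.1 k
  left_inv x := by simp [mul_assoc]
  right_inv := by
    rintro ⟨r, z, hz⟩
    have h : (z * Equiv.swap r k).symm k = r := by
      rw [← Equiv.Perm.inv_def, mul_inv_rev, Equiv.swap_inv, Equiv.Perm.mul_apply,
        Equiv.Perm.inv_def, hz]
      simp
    ext1
    · exact h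
    · apply Subtype.ext
      simp only [h, mul_assoc, Equiv.swap_mul_self, mul_one]

lemma rankEquiv_symm_rank (k : Fin m) (q : Fin m × Fixing k) :
    ((rankEquiv k).symm q).symm k = q.1 :=
  congrArg Prod.fst ((rankEquiv k).apply_symm_apply q)

/-- The profile with given ranks of `k` and given remainders. -/
def profileEquiv (k : Fin m) : (Fin n → Fin m) × (Fin n → Fixing k) ≃ Profile m n where
  toFun q i := (rankEquiv k).symm (q.1 i, q.2 i)
  invFun x := (fun i => (rankEquiv k (x i)).1, fun i => (rankEquiv k (x i)).2)
  left_inv q := by simp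
  right_inv x := by simp

lemma ranks_profileEquiv (k : Fin m) (q : (Fin n → Fin m) × (Fin n → Fixing k)) :
    ranks k (profileEquiv k q) = q.1 := by
  funext i
  exact rankEquiv_symm_rank k _

lemma update_profileEquiv (k : Fin m) (a : Fin n → Fin m) (u : Fin n → Fixing k) (i : Fin n)
    (w : Fixing k) : Function.update (profileEquiv k (a, u)) i ((rankEquiv k).symm (a i, w)) =
      profileEquiv k (a, Function.update u i w) := by
  funext j
  by_cases h : j = i
  · subst h; simp [profileEquiv]
  · simp [profileEquiv, h]

/-- The aggregated rank of `k` is, up to the violated constraints, a function of the ranks of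
`k`. -/
lemma exists_decoder (hm : 0 < m) (f : Aggregator m n) (k : Fin m) :
    ∃ G : (Fin n → Fin m) → Fin m, 𝔼 x, ind ((f x).symm k ≠ G (ranks k x)) ≤
      m * ∑ i, unifProb fun q : Profile m n × Ranking m => Violates f i k q.1 q.2 := by
  have : Nonempty (Fin m) := ⟨⟨0, hm⟩⟩
  have hm' : (m : ℝ) ≠ 0 := by positivity
  set F : (Fin n → Fin m) → (Fin n → Fixing k) → Fin m :=
    fun a u => (f (profileEquiv k (a, u))).symm k with hF
  choose G hG using fun a => exists_expect_ne_le_sum_influence (F a)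
  refine ⟨G, ?_⟩
  -- A new ranking keeps the rank of `k` with probability `1 / m`; given this, it resamples the
  -- remainder of voter `i` uniformly.
  have hviol : ∀ i, unifProb (fun q : Profile m n × Ranking m => Violates f i k q.1 q.2) =
      (𝔼 a, 𝔼 u, 𝔼 w, ind (F a u ≠ F a (Function.update u i w))) / m := by
    intro i
    rw [unifProb_eq_expect, expect_prod,
      ← Fintype.expect_equiv (profileEquiv k) _ _ fun _ => rfl, expect_prod, expect_div]
    refine expect_congr_fun fun a => ?_
    rw [expect_div]
    refine expect_congr_fun fun u => ?_
    rw [← Fintype.expect_equiv (rankEquiv k).symm _ _ fun _ => rfl, expect_prod, expect_comm,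
      expect_div]
    refine expect_congr_fun fun w => ?_
    rw [Fintype.expect_eq_sum_div_card, Fintype.card_fin, sum_eq_single (a i)]
    · congr 1
      refine ind_congr ?_
      simp only [Violates, update_profileEquiv, hF]
      refine ⟨fun h => h.2, fun h => ⟨?_, h⟩⟩
      rw [rankEquiv_symm_rank]
      exact congrFun (ranks_profileEquiv k (a, u)) i
    · intro c _ hc
      refine ind_of_not fun h => hc ?_
      have h1 := h.1
      rw [rankEquiv_symm_rank] at h1
      exact h1.symm.trans (congrFun (ranks_profileEquiv k (a, u)) i)
    · simp
  simp only [hviol]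
  rw [← sum_div, mul_div_cancel₀ _ hm', ← expect_sum_comm,
    ← Fintype.expect_equiv (profileEquiv k) _ _ fun _ => rfl, expect_prod]
  simp only [ranks_profileEquiv]
  exact expect_mono fun a => hG a

end Decoding

/-! ### The coupling of four profiles, and stability of the decoders. -/

section Coupling

variable {m n : ℕ}

/-- A ranking with rank `b` for `j` and rank `c` for `k`, unless `b = c`. -/
def pairRanking (j k b c : Fin m) (z : Fixing j) : Ranking m :=
  if c = b then (rankEquiv j).symm (b, z)
  else (rankEquiv j).symm (b, z) * Equiv.swap (((rankEquiv j).symm (b, z)).symm k) c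

/-- The information lost in `pairRanking`; it is equal to `j` if and only if `b = c`. -/
def pairToken (j k b c : Fin m) (z : Fixing j) : Fin m :=
  if c = b then j else Equiv.swap j b (((rankEquiv j).symm (b, z)).symm k)

lemma mul_swap_symm_apply (x : Ranking m) (r s : Fin m) (k : Fin m) :
    (x * Equiv.swap r s).symm k = Equiv.swap r s (x.symm k) := by
  rw [← Equiv.Perm.inv_def, mul_inv_rev, Equiv.swap_inv, Equiv.Perm.mul_apply, Equiv.Perm.inv_def]

lemma swap_mul_symm_apply (x : Ranking m) (r s : Fin m) (k : Fin m) :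
    (Equiv.swap r s * x).symm k = x.symm (Equiv.swap r s k) := by
  rw [← Equiv.Perm.inv_def, mul_inv_rev, Equiv.swap_inv, Equiv.Perm.mul_apply, Equiv.Perm.inv_def]

variable {j k : Fin m}

lemma rank_ne_of_ne (hjk : j ≠ k) (b : Fin m) (z : Fixing j) :
    ((rankEquiv j).symm (b, z)).symm k ≠ b := by
  intro h
  have h' : ((rankEquiv j).symm (b, z)).symm j = b := rankEquiv_symm_rank j (b, z)
  exact hjk (((rankEquiv j).symm (b, z)).symm.injective (h'.trans h.symm))

lemma pairRanking_rank_fst (hjk : j ≠ k) (b c : Fin m) (z : Fixing j) :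
    (pairRanking j k b c z).symm j = b := by
  unfold pairRanking
  split_ifs with h
  · exact rankEquiv_symm_rank j (b, z)
  · rw [mul_swap_symm_apply, rankEquiv_symm_rank]
    exact Equiv.swap_apply_of_ne_of_ne (rank_ne_of_ne hjk b z).symm (Ne.symm h)

lemma pairRanking_rank_snd {b c : Fin m} (h : c ≠ b) (z : Fixing j) :
    (pairRanking j k b c z).symm k = c := by
  rw [pairRanking, if_neg h, mul_swap_symm_apply, Equiv.swap_apply_left]

/-- The rank of `k` before the exchange is never `b`; relabelling by the swap of `j` and `b` frees
the value `j` to mark the degenerate case. -/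
lemma pairToken_eq_iff (hjk : j ≠ k) (b c : Fin m) (z : Fixing j) :
    pairToken j k b c z = j ↔ c = b := by
  unfold pairToken
  split_ifs with h
  · simp [h]
  · simp only [h, iff_false]
    intro h'
    refine rank_ne_of_ne hjk b z ((Equiv.swap j b).injective ?_)
    rw [h', Equiv.swap_apply_right]

/-- The ranking `pairRanking`, after an exchange of the names `j` and `k` if `T` holds and
`b ≠ c`. -/
def toggledRanking (j k : Fin m) (T : Bool) (b c : Fin m) (z : Fixing j) : Ranking m :=
  if T = true ∧ c ≠ b then Equiv.swap j k * pairRanking j k b c z else pairRanking j k b c z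

lemma toggledRanking_rank (hjk : j ≠ k) (T : Bool) (b c : Fin m) (z : Fixing j) :
    (toggledRanking j k T b c z).symm j = if T = true then c else b := by
  unfold toggledRanking
  by_cases hT : T = true
  · by_cases h : c = b
    · subst h; simp [pairRanking_rank_fst hjk]
    · rw [if_pos ⟨hT, h⟩, if_pos hT, swap_mul_symm_apply, Equiv.swap_apply_left,
        pairRanking_rank_snd h]
  · simp [hT, pairRanking_rank_fst hjk]

lemma toggledRanking_rank_of_ne (T : Bool) (b c : Fin m) (z : Fixing j) {i : Fin m}
    (hj : i ≠ j) (hk : i ≠ k) :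
    (toggledRanking j k T b c z).symm i = (pairRanking j k b c z).symm i := by
  unfold toggledRanking
  split_ifs
  · rw [swap_mul_symm_apply, Equiv.swap_apply_of_ne_of_ne hj hk]
  · rfl

/-- The token reveals whether `b = c`, hence whether names were exchanged; if `b ≠ c`, it also
recalls the old rank of `k`, so the exchange of ranks can be undone. -/
lemma toggledRanking_injective (hjk : j ≠ k) (T : Bool) {b c b' c' : Fin m} {z z' : Fixing j}
    (h : toggledRanking j k T b c z = toggledRanking j k T b' c' z')
    (ht : pairToken j k b c z = pairToken j k b' c' z') : b = b' ∧ c = c' ∧ z = z' := by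
  have hiff : c = b ↔ c' = b' := by
    rw [← pairToken_eq_iff hjk b c z, ht, pairToken_eq_iff hjk]
  have hp : pairRanking j k b c z = pairRanking j k b' c' z' := by
    unfold toggledRanking at h
    by_cases hT : T = true ∧ c ≠ b
    · rw [if_pos hT, if_pos ⟨hT.1, fun h' => hT.2 (hiff.2 h')⟩] at h
      exact mul_left_cancel h
    · rwa [if_neg hT, if_neg fun h' => hT ⟨h'.1, fun h'' => h'.2 (hiff.1 h'')⟩] at h
  have hb : b = b' := by
    rw [← pairRanking_rank_fst hjk b c z, hp, pairRanking_rank_fst hjk]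
  subst hb
  by_cases hc : c = b
  · have hc' := hiff.1 hc
    subst hc
    subst hc'
    unfold pairRanking at hp
    simp only [if_true] at hp
    exact ⟨rfl, rfl, congrArg Prod.snd ((rankEquiv j).symm.injective hp)⟩
  · have hc' : c' ≠ b := fun h' => hc (hiff.2 h')
    have hcc : c = c' := by
      rw [← pairRanking_rank_snd hc z, hp, pairRanking_rank_snd hc']
    subst hcc
    refine ⟨rfl, rfl, ?_⟩
    simp only [pairToken, if_neg hc] at ht
    have ht' := (Equiv.swap j b).injective ht
    simp only [pairRanking, if_neg hc, ht'] at hp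
    exact congrArg Prod.snd ((rankEquiv j).symm.injective (mul_right_cancel hp))

/-- Two points and the remainders of the rankings; the data from which coupled profiles are
made. -/
abbrev CouplingData (n : ℕ) (j : Fin m) : Type :=
  (Fin n → Fin m) × (Fin n → Fin m) × (Fin n → Fixing j)

/-- The coupled profiles: the voters before the time `σ` exchange `j` and `l` if `u` holds, the
others exchange `j` and `k` if `v` holds. -/
def coupledProfile (j k l : Fin m) (σ : (Fin n → Fin m) → ℕ) (u v : Bool)
    (q : CouplingData n j) : Profile m n := fun i =>
  if (i : ℕ) < σ q.1 then toggledRanking j l u (q.1 i) (q.2.1 i) (q.2.2 i)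
  else toggledRanking j k v (q.1 i) (q.2.1 i) (q.2.2 i)

/-- The tokens that belong to `coupledProfile`. -/
def coupledTokens (j k l : Fin m) (σ : (Fin n → Fin m) → ℕ) (q : CouplingData n j) :
    Fin n → Fin m := fun i =>
  if (i : ℕ) < σ q.1 then pairToken j l (q.1 i) (q.2.1 i) (q.2.2 i)
  else pairToken j k (q.1 i) (q.2.1 i) (q.2.2 i)

variable {l : Fin m} {σ : (Fin n → Fin m) → ℕ}

/-- Voters below the smaller of the two times follow the same rule, so their data agree; adaptedness
then equates the times, and the other voters can be decoded. With `card_couplingData` this makes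
every coupled profile uniform. -/
lemma coupledProfile_injective (hjk : j ≠ k) (hjl : j ≠ l) (hσ : IsAdapted σ) (u v : Bool) :
    Function.Injective fun q : CouplingData n j =>
      (coupledProfile j k l σ u v q, coupledTokens j k l σ q) := by
  have main : ∀ q q' : CouplingData n j, σ q.1 ≤ σ q'.1 →
      coupledProfile j k l σ u v q = coupledProfile j k l σ u v q' →
      coupledTokens j k l σ q = coupledTokens j k l σ q' → q = q' := by
    rintro ⟨b, c, z⟩ ⟨b', c', z'⟩ hle hp ht
    simp only at hle
    have hσ' : σ b' = σ b := by
      refine hσ b b' fun i hi => ?_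
      have hp' := congrFun hp i
      have ht' := congrFun ht i
      simp only [coupledProfile, coupledTokens, if_pos hi, if_pos (hi.trans_le hle)] at hp' ht'
      exact (toggledRanking_injective hjl u hp' ht').1.symm
    have hall : ∀ i, b i = b' i ∧ c i = c' i ∧ z i = z' i := by
      intro i
      have hp' := congrFun hp i
      have ht' := congrFun ht i
      simp only [coupledProfile, coupledTokens, hσ'] at hp' ht'
      by_cases hi : (i : ℕ) < σ b
      · simp only [if_pos hi] at hp' ht'
        exact toggledRanking_injective hjl u hp' ht'
      · simp only [if_neg hi] at hp' ht'
        exact toggledRanking_injective hjk v hp' ht'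
    rw [show b = b' from funext fun i => (hall i).1, show c = c' from funext fun i => (hall i).2.1,
      show z = z' from funext fun i => (hall i).2.2]
  intro q q' h
  obtain ⟨hp, ht⟩ := Prod.mk.inj h
  rcases le_total (σ q.1) (σ q'.1) with hle | hle
  · exact main q q' hle hp ht
  · exact (main q' q hle hp.symm ht.symm).symm

lemma card_couplingData (n : ℕ) (j : Fin m) :
    Fintype.card (CouplingData n j) = Fintype.card (Profile m n × (Fin n → Fin m)) := by
  have h := Fintype.card_congr (rankEquiv j)
  rw [Fintype.card_prod, Fintype.card_fin] at h
  rw [Fintype.card_prod, Fintype.card_prod, Fintype.card_prod, Fintype.card_fun, Fintype.card_fun,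
    Fintype.card_fun, Fintype.card_fin, Fintype.card_fin, h, mul_pow]
  ring

lemma ranks_coupledProfile (hjk : j ≠ k) (hjl : j ≠ l) (u v : Bool) (q : CouplingData n j) :
    ranks j (coupledProfile j k l σ u v q) =
      mix (σ q.1) (if u = true then q.2.1 else q.1) (if v = true then q.2.1 else q.1) := by
  funext i
  simp only [ranks, coupledProfile, mix]
  split_ifs <;> simp_all [toggledRanking_rank]

lemma ranks_coupledProfile_of_ne_snd (u u' v : Bool) (q : CouplingData n j) {i : Fin m}
    (hj : i ≠ j) (hl : i ≠ l) :
    ranks i (coupledProfile j k l σ u v q) = ranks i (coupledProfile j k l σ u' v q) := by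
  funext r
  simp only [ranks, coupledProfile]
  split_ifs
  · rw [toggledRanking_rank_of_ne _ _ _ _ hj hl, toggledRanking_rank_of_ne _ _ _ _ hj hl]
  · rfl

lemma ranks_coupledProfile_of_ne_fst (u v v' : Bool) (q : CouplingData n j) {i : Fin m}
    (hj : i ≠ j) (hk : i ≠ k) :
    ranks i (coupledProfile j k l σ u v q) = ranks i (coupledProfile j k l σ u v' q) := by
  funext r
  simp only [ranks, coupledProfile]
  split_ifs
  · rfl
  · rw [toggledRanking_rank_of_ne _ _ _ _ hj hk, toggledRanking_rank_of_ne _ _ _ _ hj hk]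

lemma sum_ite_perm_eq_one (s : Equiv.Perm (Fin m)) (r : Fin m) :
    ∑ c, (if s c = r then (1 : ℤ) else 0) = 1 := by
  simp only [← Equiv.eq_symm_apply]
  simp

/-- If four permutations satisfy the additive relation at all points but one, then they satisfy it
there. -/
lemma samePair_of_perm {A B C D : Equiv.Perm (Fin m)} (j : Fin m)
    (h : ∀ c, c ≠ j → SamePair (A c) (B c) (C c) (D c)) : SamePair (A j) (B j) (C j) (D j) := by
  -- Each permutation takes the value `r` exactly once, so the signed counts cancel over all points;
  -- they vanish at every point but `j`, hence also there.
  have key : ∀ r, (if A j = r then (1 : ℤ) else 0) + (if B j = r then 1 else 0) -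
      (if C j = r then 1 else 0) - (if D j = r then 1 else 0) = 0 := by
    intro r
    rw [← sum_eq_single (s := univ) (f := fun c => (if A c = r then (1 : ℤ) else 0) +
      (if B c = r then 1 else 0) - (if C c = r then 1 else 0) - (if D c = r then 1 else 0)) j]
    · simp only [sum_sub_distrib, sum_add_distrib, sum_ite_perm_eq_one]
      norm_num
    · intro c _ hc
      rcases h c hc with ⟨h1, h2⟩ | ⟨h1, h2⟩
      · rw [h1, h2]; ring
      · rw [h1, h2]; ring
    · simp
  have h1 := key (A j)
  have h2 := key (B j)
  unfold SamePair
  grind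

/-- If all aggregated ranks are decoded from the ranks of the same alternative with failure
probability `β`, then the decoders are crossing stable. -/
lemma crossingStable_decoder (hm : 3 ≤ m) (f : Aggregator m n)
    (G : Fin m → (Fin n → Fin m) → Fin m) (j : Fin m) :
    CrossingStable (4 * 𝔼 x, ind (∃ k, (f x).symm k ≠ G k (ranks k x))) (G j) := by
  intro σ hσ
  obtain ⟨k, hkj⟩ : ∃ k, k ≠ j := by
    have : Nontrivial (Fin m) := Fin.nontrivial_iff_two_le.2 (by omega)
    exact exists_ne j
  obtain ⟨l, hlj, hlk⟩ : ∃ l, l ≠ j ∧ l ≠ k := by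
    have : ({j, k} : Finset (Fin m)).card < Fintype.card (Fin m) := by
      rw [Fintype.card_fin]; exact card_le_two.trans_lt hm
    obtain ⟨l, -, hl⟩ := exists_mem_notMem_of_card_lt_card (s := {j, k}) (t := univ) this
    exact ⟨l, by simpa using hl⟩
  set P := fun (u v : Bool) (q : CouplingData n j) => coupledProfile j k l σ u v q with hP
  set bad : Profile m n → Prop := fun x => ∃ k, (f x).symm k ≠ G k (ranks k x) with hbad
  have hunif : ∀ u v, 𝔼 q, ind (bad (P u v q)) = 𝔼 x, ind (bad x) := by
    intro u v
    rw [expect_comp_injective (coupledProfile_injective hkj.symm hlj.symm hσ u v)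
      (card_couplingData n j) fun p => ind (bad p.1), expect_prod]
    have : Nonempty (Fin m) := ⟨j⟩
    exact expect_congr_fun fun x => Fintype.expect_const (ind (bad x))
  have hpt : ∀ q : CouplingData n j, ind (¬SamePair (G j q.1) (G j q.2.1)
      (G j (mix (σ q.1) q.1 q.2.1)) (G j (mix (σ q.1) q.2.1 q.1))) ≤
      (ind (bad (P false false q)) + ind (bad (P true true q))) +
        (ind (bad (P false true q)) + ind (bad (P true false q))) := by
    intro q
    by_cases hall : ∀ u v, ¬bad (P u v q)
    · have hdec : ∀ u v c, (f (P u v q)).symm c = G c (ranks c (P u v q)) := by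
        intro u v c
        by_contra h
        exact hall u v ⟨c, h⟩
      rw [ind_of_not]
      · have := fun u v => ind_nonneg (bad (P u v q))
        have h1 := this false false
        have h2 := this true true
        have h3 := this false true
        have h4 := this true false
        linarith
      · rw [not_not]
        have := samePair_of_perm (A := (f (P false false q)).symm) (B := (f (P true true q)).symm)
          (C := (f (P false true q)).symm) (D := (f (P true false q)).symm) j ?_
        · simp only [hdec] at this
          simpa [hP, ranks_coupledProfile hkj.symm hlj.symm, mix_self] using this
        · intro c hc
          simp only [hdec]
          -- The alternative `k` ignores the switch `u`, and all others except `j` ignore `v`; this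
          -- decides how the pairs match.
          by_cases hck : c = k
          · have hcl : c ≠ l := by rw [hck]; exact hlk.symm
            right
            constructor
            · rw [ranks_coupledProfile_of_ne_snd false true false q hc hcl]
            · rw [ranks_coupledProfile_of_ne_snd true false true q hc hcl]
          · left
            constructor
            · rw [ranks_coupledProfile_of_ne_fst false false true q hc hck]
            · rw [ranks_coupledProfile_of_ne_fst true true false q hc hck]
    · push Not at hall
      obtain ⟨u, v, huv⟩ := hall
      refine (ind_le_one _).trans ?_
      have := fun u v => ind_nonneg (bad (P u v q))
      have h1 := this false false
      have h2 := this true true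
      have h3 := this false true
      have h4 := this true false
      rw [← ind_of huv]
      cases u <;> cases v <;> linarith
  calc _ = 𝔼 q : CouplingData n j, ind (¬SamePair (G j q.1) (G j q.2.1)
      (G j (mix (σ q.1) q.1 q.2.1)) (G j (mix (σ q.1) q.2.1 q.1))) := by
        rw [expect_prod]
        refine expect_congr_fun fun b => ?_
        rw [expect_prod]
        exact expect_congr_fun fun c => (Fintype.expect_const _).symm
    _ ≤ _ := expect_mono hpt
    _ = _ := by
        simp only [expect_add_distrib, hunif]
        ring

end Coupling

/-! ### From single-voter decoders to constant or dictatorial aggregators. -/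

section Structure

variable {m n : ℕ}

lemma expect_ranks (k : Fin m) (φ : (Fin n → Fin m) → ℝ) :
    𝔼 x : Profile m n, φ (ranks k x) = 𝔼 b, φ b := by
  rw [← Fintype.expect_equiv (profileEquiv k) _ _ fun _ => rfl, expect_prod]
  simp only [ranks_profileEquiv]
  exact expect_congr_fun fun b => Fintype.expect_const _

/-- Each aggregated rank depends, up to a small probability, on one voter only. -/
lemma exists_voterwise_decoder (hm : 3 ≤ m) (hn : 0 < n) (f : Aggregator m n)
    (hf : 1600 * (m : ℝ) ^ 3 * irRate f ≤ 1) :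
    ∃ (s : Fin m → Fin n) (g : Fin m → Fin m → Fin m),
      𝔼 x, ind (∃ k, (f x).symm k ≠ g k ((x (s k)).symm k)) ≤ 385 * (m : ℝ) ^ 3 * irRate f := by
  have : Nonempty (Fin m) := ⟨⟨0, by omega⟩⟩
  have hm1 : (1 : ℝ) ≤ m := by exact_mod_cast (by omega : 1 ≤ m)
  choose G hG using exists_decoder (by omega : 0 < m) f
  set β : ℝ := 𝔼 x, ind (∃ k, (f x).symm k ≠ G k (ranks k x)) with hβ
  have hβ0 : 0 ≤ β := expect_ind_nonneg _
  have hβ1 : β ≤ m * irRate f := by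
    calc β ≤ 𝔼 x, ∑ k, ind ((f x).symm k ≠ G k (ranks k x)) :=
          expect_mono fun x => ind_exists_le_sum _
      _ = ∑ k, 𝔼 x, ind ((f x).symm k ≠ G k (ranks k x)) := expect_sum_comm _ _ _
      _ ≤ ∑ k, m * ∑ i, unifProb fun q : Profile m n × Ranking m => Violates f i k q.1 q.2 :=
          sum_le_sum fun k _ => hG k
      _ = m * irRate f := by rw [← mul_sum, irRate, sum_comm]
  have hclose : ∀ k, ∃ (s : Fin n) (g : Fin m → Fin m),
      𝔼 b, ind (G k b ≠ g (b s)) ≤ 96 * m * (4 * β) := by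
    intro k
    have h := (crossingStable_decoder hm f G k).exists_close hn
    rw [Fintype.card_fin] at h
    refine h ?_
    rw [← hβ]
    have : (m : ℝ) ^ 2 * β ≤ m ^ 2 * (m * irRate f) :=
      mul_le_mul_of_nonneg_left hβ1 (by positivity)
    nlinarith
  choose s g hsg using hclose
  refine ⟨s, g, ?_⟩
  have hpt : ∀ x, ind (∃ k, (f x).symm k ≠ g k ((x (s k)).symm k)) ≤
      ind (∃ k, (f x).symm k ≠ G k (ranks k x)) +
        ∑ k, ind (G k (ranks k x) ≠ g k (ranks k x (s k))) := by
    intro x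
    refine le_trans (ind_le_add (r := ∃ k, G k (ranks k x) ≠ g k (ranks k x (s k))) ?_)
      (add_le_add_right (ind_exists_le_sum _) _)
    rintro ⟨k, hk⟩
    by_contra! h
    exact hk ((h.1 k).trans (h.2 k))
  have hsum : 𝔼 x : Profile m n, ∑ k, ind (G k (ranks k x) ≠ g k (ranks k x (s k))) ≤
      m * (96 * m * (4 * β)) := by
    rw [expect_sum_comm]
    calc _ ≤ ∑ _k : Fin m, 96 * m * (4 * β) := sum_le_sum fun k _ => by
          rw [expect_ranks k fun b => ind (G k b ≠ g k (b (s k)))]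
          exact hsg k
      _ = _ := by simp
  calc _ ≤ β + m * (96 * m * (4 * β)) := by
        refine (expect_mono hpt).trans ?_
        rw [expect_add_distrib]
        exact add_le_add_right hsum _
    -- Here 385 = 1 + 96 · 4, the lone `β` being absorbed by `1 ≤ m ^ 2`.
    _ ≤ (385 * m ^ 2) * β := by
        linarith [le_mul_of_one_le_left hβ0 (one_le_pow₀ (n := 2) hm1)]
    _ ≤ (385 * m ^ 2) * (m * irRate f) := mul_le_mul_of_nonneg_left hβ1 (by positivity)
    _ = _ := by ring

/-- The profile in which voter `i` moves the alternative `k` to rank `r` by an exchange. -/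
def setRank (i : Fin n) (k r : Fin m) (x : Profile m n) : Profile m n :=
  Function.update x i (x i * Equiv.swap ((x i).symm k) r)

lemma setRank_rank (i : Fin n) (k r : Fin m) (x : Profile m n) :
    (setRank i k r x i).symm k = r := by
  rw [setRank, Function.update_self, mul_swap_symm_apply, Equiv.swap_apply_left]

lemma setRank_of_ne {i i' : Fin n} (h : i' ≠ i) (k r : Fin m) (x : Profile m n) :
    setRank i k r x i' = x i' := by
  rw [setRank, Function.update_of_ne h]

lemma setRank_rank_of_ne (i : Fin n) {j k a b : Fin m} {x : Profile m n} (hjk : j ≠ k)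
    (hab : a ≠ b) (h : (x i).symm j = a) : (setRank i k b x i).symm j = a := by
  rw [setRank, Function.update_self, mul_swap_symm_apply, h]
  refine Equiv.swap_apply_of_ne_of_ne (fun h' => hjk ?_) hab
  exact (x i).symm.injective (h.trans h')

/-- The new profile and the old rank of `k` determine the old profile, so `setRank` is at most
`m`-to-one. -/
lemma expect_setRank_le (i : Fin n) (k r : Fin m) {φ : Profile m n → ℝ} (hφ : ∀ x, 0 ≤ φ x) :
    𝔼 x, φ (setRank i k r x) ≤ m * 𝔼 x, φ x := by
  classical
  have hinj : Function.Injective fun x : Profile m n => (setRank i k r x, (x i).symm k) := by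
    have hrec : ∀ x : Profile m n, x = Function.update (setRank i k r x) i
        (setRank i k r x i * Equiv.swap ((x i).symm k) r) := by
      intro x
      simp [setRank, mul_assoc]
    intro x y h
    obtain ⟨h1, h2⟩ := Prod.mk.inj h
    rw [hrec x, hrec y, h1, h2]
  rw [Fintype.expect_eq_sum_div_card, Fintype.expect_eq_sum_div_card, ← mul_div_assoc]
  refine div_le_div_of_nonneg_right ?_ (by positivity)
  calc ∑ x, φ (setRank i k r x)
      = ∑ q ∈ univ.image fun x : Profile m n => (setRank i k r x, (x i).symm k), φ q.1 :=
        (sum_image (f := fun q : Profile m n × Fin m => φ q.1) hinj.injOn).symm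
    _ ≤ ∑ q : Profile m n × Fin m, φ q.1 :=
        sum_le_univ_sum_of_nonneg fun q => hφ q.1
    _ = m * ∑ x, φ x := by
        rw [Fintype.sum_prod_type, mul_sum]
        simp

/-- Voterwise decoders that fail with small probability are compatible. -/
lemma decoder_ne_decoder {f : Aggregator m n} {s : Fin m → Fin n}
    {g : Fin m → Fin m → Fin m}
    (h : (m : ℝ) * m * 𝔼 x, ind (∃ k, (f x).symm k ≠ g k ((x (s k)).symm k)) < 1)
    {j k a b : Fin m} (hjk : j ≠ k) (hab : a ≠ b ∨ s j ≠ s k) : g j a ≠ g k b := by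
  intro heq
  set bad : Profile m n → Prop := fun x => ∃ k, (f x).symm k ≠ g k ((x (s k)).symm k) with hbad
  -- Both ranks can be imposed at once, which costs a factor `m` each. Were the two decoded values
  -- equal, decoding would fail on every profile so modified.
  have hall : ∀ x, bad (setRank (s k) k b (setRank (s j) j a x)) := by
    intro x
    set y := setRank (s k) k b (setRank (s j) j a x) with hy
    have hk : (y (s k)).symm k = b := setRank_rank _ _ _ _
    have hj : (y (s j)).symm j = a := by
      by_cases hs : s j = s k
      · rw [hs, hy]
        refine setRank_rank_of_ne _ hjk (hab.resolve_right fun h' => h' hs) ?_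
        rw [← hs]
        exact setRank_rank _ _ _ _
      · rw [hy, setRank_of_ne hs]
        exact setRank_rank _ _ _ _
    by_contra hgood
    simp only [hbad, not_exists, not_not] at hgood
    have h1 := hgood j
    have h2 := hgood k
    rw [hj] at h1
    rw [hk] at h2
    exact hjk ((f y).symm.injective (h1.trans (heq.trans h2.symm)))
  have h1 : (1 : ℝ) = 𝔼 x : Profile m n, ind (bad (setRank (s k) k b (setRank (s j) j a x))) := by
    rw [expect_congr_fun fun x => ind_of (hall x), Fintype.expect_const]
  have h2 := expect_setRank_le (s j) j a (φ := fun x => ind (bad (setRank (s k) k b x)))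
    fun _ => ind_nonneg _
  have h3 := mul_le_mul_of_nonneg_left (expect_setRank_le (s k) k b (φ := fun x => ind (bad x))
    fun _ => ind_nonneg _) (Nat.cast_nonneg (α := ℝ) m)
  rw [← mul_assoc] at h3
  linarith

lemma exists_perm_apply_eq {j k a b : Fin m} (hjk : j ≠ k) (hab : a ≠ b) :
    ∃ t : Equiv.Perm (Fin m), t j = a ∧ t k = b := by
  refine ⟨Equiv.swap (Equiv.swap j a k) b * Equiv.swap j a, ?_, ?_⟩
  · rw [Equiv.Perm.mul_apply, Equiv.swap_apply_left]
    refine Equiv.swap_apply_of_ne_of_ne (fun h => hjk ?_) hab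
    apply (Equiv.swap j a).injective
    rw [← h, Equiv.swap_apply_left]
  · rw [Equiv.Perm.mul_apply, Equiv.swap_apply_left]

/-- Compatible families of functions admit exchanges of arguments. -/
lemma decoder_exchange {g : Fin m → Fin m → Fin m}
    (hg : ∀ j k a b, j ≠ k → a ≠ b → g j a ≠ g k b) {j k a b : Fin m} (hjk : j ≠ k)
    (hab : a ≠ b) : g j a = g j b ∨ g j a = g k a := by
  obtain ⟨t, htj, htk⟩ := exists_perm_apply_eq hjk hab
  have hinj : ∀ t : Equiv.Perm (Fin m), Function.Injective fun c => g c (t c) := by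
    intro t c d h
    by_contra hcd
    exact hg c d _ _ hcd (fun h' => hcd (t.injective h')) h
  -- Exchanging the arguments of `j` and `k` gives another bijection, which still attains `g j a`.
  -- Only its values at `j` and `k` have changed, so it does so at one of these.
  obtain ⟨c, hc⟩ := (Finite.injective_iff_surjective.1 (hinj (t * Equiv.swap j k))) (g j a)
  simp only [Equiv.Perm.mul_apply] at hc
  by_cases hcj : c = j
  · rw [hcj, Equiv.swap_apply_left, htk] at hc
    exact Or.inl hc.symm
  · by_cases hck : c = k
    · rw [hck, Equiv.swap_apply_right, htj] at hc
      exact Or.inr hc.symm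
    · rw [Equiv.swap_apply_of_ne_of_ne hcj hck, ← htj] at hc
      exact absurd (hinj t hc) hcj

/-- A compatible family of functions of single voters describes a constant or a dictatorial
aggregator. -/
lemma exists_constant_or_dictatorial (hm : 2 ≤ m) {s : Fin m → Fin n}
    {g : Fin m → Fin m → Fin m}
    (hg : ∀ j k a b, j ≠ k → (a ≠ b ∨ s j ≠ s k) → g j a ≠ g k b) :
    ∃ h : Aggregator m n, (IsConstant h ∨ IsDictatorial h) ∧
      ∀ x k, (h x).symm k = g k ((x (s k)).symm k) := by
  have hnt : Nontrivial (Fin m) := Fin.nontrivial_iff_two_le.2 hm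
  have hg' : ∀ j k a b, j ≠ k → a ≠ b → g j a ≠ g k b := fun j k a b h h' => hg j k a b h (Or.inl h')
  by_cases hc : ∀ j a b, g j a = g j b
  · have hinj : Function.Injective fun j => g j j := by
      intro j k h
      by_contra hjk
      exact hg' j k j k hjk hjk h
    refine ⟨fun _ => (Equiv.ofBijective _ (Finite.injective_iff_bijective.1 hinj)).symm,
      Or.inl ⟨_, fun _ => rfl⟩, fun x k => ?_⟩
    rw [Equiv.symm_symm, Equiv.ofBijective_apply]
    exact hc _ _ _
  · push Not at hc
    obtain ⟨j, a, b, hab⟩ := hc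
    -- As `g j` is not constant, every `c` has a `d` with `g j c ≠ g j d`, which excludes the first
    -- outcome of the exchange.
    have heq : ∀ k c, g k c = g j c := by
      intro k c
      by_cases hkj : k = j
      · rw [hkj]
      · obtain ⟨d, hd⟩ : ∃ d, g j c ≠ g j d := by
          by_cases h : g j c = g j a
          · exact ⟨b, h ▸ hab⟩
          · exact ⟨a, h⟩
        exact ((decoder_exchange hg' (Ne.symm hkj) fun h => hd (congrArg _ h)).resolve_left hd).symm
    have hs : ∀ k, s k = s j := by
      intro k
      by_contra hk
      exact hg j k a a (fun h => hk (h ▸ rfl)) (Or.inr (Ne.symm hk)) (heq k a).symm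
    have hinj : Function.Injective (g j) := by
      intro c d h
      by_contra hcd
      obtain ⟨k, hk⟩ := exists_ne j
      exact hg' j k c d hk.symm hcd (h.trans (heq k d).symm)
    set π : Equiv.Perm (Fin m) := Equiv.ofBijective _ (Finite.injective_iff_bijective.1 hinj)
    refine ⟨fun x => x (s j) * π.symm, Or.inr ⟨s j, π.symm, fun x r => rfl⟩, fun x k => ?_⟩
    rw [heq, hs k]
    rfl

end Structure

/-! ### Comparison of the distances and the final bound. -/

section Distances

variable {m n : ℕ}

lemma permMatrix_sub_sq_sum_le (z w : Ranking m) :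
    ∑ r, ∑ j, (z.permMatrix ℝ r j - w.permMatrix ℝ r j) ^ 2 ≤ 2 * m * ind (z ≠ w) := by
  by_cases h : z = w
  · subst h; simp [ind]
  · rw [ind_of h, mul_one]
    have hrow : ∀ r, ∑ j, (z.permMatrix ℝ r j - w.permMatrix ℝ r j) ^ 2 ≤ 2 := by
      intro r
      calc ∑ j, (z.permMatrix ℝ r j - w.permMatrix ℝ r j) ^ 2
          ≤ ∑ j, ((if z r = j then (1 : ℝ) else 0) + if w r = j then 1 else 0) := by
            refine sum_le_sum fun j _ => ?_
            simp only [Equiv.Perm.permMatrix, PEquiv.toMatrix_apply, Equiv.toPEquiv_apply,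
              Option.mem_some_iff]
            split_ifs <;> norm_num
        _ = 2 := by
            rw [sum_add_distrib]
            simp only [sum_ite_eq, mem_univ, if_true]
            norm_num
    calc _ ≤ ∑ _r : Fin m, (2 : ℝ) := sum_le_sum fun r _ => hrow r
      _ = 2 * m := by simp [mul_comm]

lemma dist_eq_expect (f h : Aggregator m n) : dist f h = 𝔼 x, ind (f x ≠ h x) :=
  unifProb_eq_expect _

lemma distL2Sq_le (f h : Aggregator m n) : distL2Sq f h ≤ 2 * m * dist f h := by
  rw [dist_eq_expect, distL2Sq, Fintype.expect_eq_sum_div_card, ← mul_div_assoc, mul_sum]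
  exact div_le_div_of_nonneg_right (sum_le_sum fun x _ => permMatrix_sub_sq_sum_le _ _)
    (Nat.cast_nonneg _)

lemma irRate_nonneg (f : Aggregator m n) : 0 ≤ irRate f :=
  sum_nonneg fun _ _ => sum_nonneg fun _ _ => div_nonneg (Nat.cast_nonneg _) (Nat.cast_nonneg _)

lemma exists_dist_le (hm : 3 ≤ m) (f : Aggregator m n) :
    ∃ h : Aggregator m n, (IsConstant h ∨ IsDictatorial h) ∧
      dist f h ≤ 1600 * (m : ℝ) ^ 5 * irRate f := by
  have hm3 : (3 : ℝ) ≤ m := by exact_mod_cast hm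
  have hε := irRate_nonneg f
  rcases Nat.eq_zero_or_pos n with hn | hn
  · subst hn
    refine ⟨f, Or.inl ⟨f default, fun x => congrArg f (Subsingleton.elim _ _)⟩, ?_⟩
    rw [dist_eq_expect]
    simp only [ne_eq, not_true_eq_false, ind_of_not, not_false_eq_true, expect_const_zero]
    positivity
  -- Smallness gives both the hypothesis of the voterwise decoding and an error below `1 / m ^ 2`;
  -- otherwise the claimed bound is at least 1 and any constant will do.
  · by_cases hsmall : 1600 * (m : ℝ) ^ 5 * irRate f < 1
    · have hpow : (m : ℝ) ^ 3 * irRate f ≤ (m : ℝ) ^ 5 * irRate f :=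
        mul_le_mul_of_nonneg_right (pow_le_pow_right₀ (by linarith) (by norm_num)) hε
      obtain ⟨s, g, hsg⟩ := exists_voterwise_decoder hm hn f (by linarith)
      have hbound : (m : ℝ) * m * 𝔼 x, ind (∃ k, (f x).symm k ≠ g k ((x (s k)).symm k)) < 1 := by
        calc _ ≤ (m : ℝ) * m * (385 * (m : ℝ) ^ 3 * irRate f) :=
              mul_le_mul_of_nonneg_left hsg (by positivity)
          _ = 385 * ((m : ℝ) ^ 5 * irRate f) := by ring
          _ < 1 := by linarith [mul_nonneg (pow_nonneg (Nat.cast_nonneg (α := ℝ) m) 5) hε]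
      obtain ⟨h, hh, hgh⟩ := exists_constant_or_dictatorial (by omega)
        fun j k a b => decoder_ne_decoder hbound (j := j) (k := k) (a := a) (b := b)
      refine ⟨h, hh, ?_⟩
      rw [dist_eq_expect]
      calc _ ≤ 𝔼 x, ind (∃ k, (f x).symm k ≠ g k ((x (s k)).symm k)) := by
            refine expect_mono fun x => ind_mono fun hne => ?_
            by_contra! hall
            refine hne (Equiv.symm_bijective.injective (Equiv.ext fun k => ?_))
            rw [hall, hgh]
        _ ≤ 385 * (m : ℝ) ^ 3 * irRate f := hsg
        _ ≤ _ := by linarith [mul_nonneg (pow_nonneg (Nat.cast_nonneg (α := ℝ) m) 5) hε]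
    · refine ⟨fun _ => 1, Or.inl ⟨1, fun _ => rfl⟩, ?_⟩
      rw [dist_eq_expect]
      exact (expect_ind_le_one _).trans (not_lt.1 hsmall)

end Distances

end RobustSWF

theorem theorem3p2 :
    ∃ C : ℝ, 0 < C ∧
      ∀ (m n : ℕ) (ε : ℝ) (f : RobustSWF.Aggregator m n), 3 ≤ m → RobustSWF.IsEpsIR ε f →
        ∃ h : RobustSWF.Aggregator m n,
          (RobustSWF.IsConstant h ∨ RobustSWF.IsDictatorial h) ∧
            RobustSWF.dist f h ≤ C * (m : ℝ) ^ 8 * ε ∧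
            RobustSWF.distL2Sq f h ≤ C * (m : ℝ) ^ 8 * ε := by
  refine ⟨3200, by norm_num, fun m n ε f hm hf => ?_⟩
  obtain ⟨h, hh, hd⟩ := RobustSWF.exists_dist_le hm f
  have hm1 : (1 : ℝ) ≤ m := by exact_mod_cast (by omega : 1 ≤ m)
  have hε0 : 0 ≤ ε := (RobustSWF.irRate_nonneg f).trans hf
  have hd' : RobustSWF.dist f h ≤ 1600 * (m : ℝ) ^ 5 * ε :=
    hd.trans (mul_le_mul_of_nonneg_left hf (by positivity))
  have h5 : (m : ℝ) ^ 5 * ε ≤ (m : ℝ) ^ 8 * ε :=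
    mul_le_mul_of_nonneg_right (pow_le_pow_right₀ hm1 (by norm_num)) hε0
  have h6 : (m : ℝ) ^ 6 * ε ≤ (m : ℝ) ^ 8 * ε :=
    mul_le_mul_of_nonneg_right (pow_le_pow_right₀ hm1 (by norm_num)) hε0
  refine ⟨h, hh, ?_, ?_⟩
  · linarith [mul_nonneg (pow_nonneg (Nat.cast_nonneg (α := ℝ) m) 8) hε0]
  · calc RobustSWF.distL2Sq f h ≤ 2 * m * RobustSWF.dist f h := RobustSWF.distL2Sq_le f h
      _ ≤ 2 * m * (1600 * (m : ℝ) ^ 5 * ε) := mul_le_mul_of_nonneg_left hd' (by positivity)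
      _ = 3200 * ((m : ℝ) ^ 6 * ε) := by ring
      _ ≤ 3200 * (m : ℝ) ^ 8 * ε := by linarith
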